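/- Let $|\psi\rangle\in(\mathbb C^2)^{\otimes 3}$ be a unit vector (a pure state of three qubits $A,B,C$), let $\{i,j,k\}=\{A,B,C\}$, and for distinct parties $l,m$ let $\rho_{lm}$ be the two-qubit reduced state of $|\psi\rangle\langle\psi|$, obtained by tracing out the remaining party. For a two-qubit state $\rho$: - let $T=(t_{mn})$, $t_{mn}=\mathrm{Tr}[\rho\,\sigma_m\otimes\sigma_n]$, be its correlation matrix, where $\sigma_1,\sigma_2,\sigma_3$ are the Pauli matrices, and let $S(\rho)=\mathrm{Tr}[T^{T}T]$; - let $\mathcal C(\rho)=\max\{0,l_1-l_2-l_3-l_4\}$ be its concurrence, where $l_1\ge l_2\ge l_3\ge l_4$ are the square roots of the eigenvalues of $\rho\,(\sigma_2\otimes\sigma_2)\rho^*(\sigma_2\otimes\sigma_2)$ and $\rho^*$ is the entrywise complex conjugate of $\rho$; - say that $\rho$ violates the $F_3$ inequality (the three-settings CJWR linear steering inequality) if there are unit vectors $a_1,a_2,a_3\in\mathbb R^3$ and orthonormal vectors $b_1,b_2,b_3\in\mathbb R^3$ with $$\frac1{\sqrt3}\Bigl|\sum_{r=1}^3\mathrm{Tr}\bigl[\rho\,(a_r\cdot\vec\sigma)\otimes(b_r\cdot\vec\sigma)\bigr]\Bigr|>1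 .$$ Write $S_{lm}=S(\rho_{lm})$ and $\mathcal C_{lm}=\mathcal C(\rho_{lm})$. Then $$S_{ij}=1+2\,\mathcal C_{ij}^2-\mathcal C_{ik}^2-\mathcal C_{jk}^2 .$$ Consequently, $S_{ij}>1$ if and only if $\mathcal C_{ij}^2>\tfrac12(\mathcal C_{ik}^2+\mathcal C_{jk}^2)$; and $\rho_{ij}$ violates the $F_3$ inequality if and only if $\mathcal C_{ij}^2>\tfrac12(\mathcal C_{ik}^2+\mathcal C_{jk}^2)$. -/

import Mathlib

noncomputable section

namespace ThreeQubit

open scoped Kronecker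

/-- The Hilbert space of three qubits; the parties `A`, `B`, `C` are `0`, `1`, `2 : Fin 3`, and
the computational basis vector `|s 0, s 1, s 2⟩` is indexed by `s : Fin 3 → Fin 2`. -/
abbrev Space : Type := EuclideanSpace ℂ (Fin 3 → Fin 2)

/-- The operator `|ψ⟩⟨ψ|`. -/
def pureDensity (ψ : Space) : Matrix (Fin 3 → Fin 2) (Fin 3 → Fin 2) ℂ :=
  Matrix.of fun s t => ψ s * star (ψ t)

/-- The reduced two-qubit operator `ρ_{ij}` of the (distinct) parties `i`, `j`: the partial trace
of `ρ` over the remaining party. The row index `s` runs over the extensions of `p` to all parties,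
and the column index agrees with `s` except that `i`, `j` carry the values `q`. -/
def reduced (ρ : Matrix (Fin 3 → Fin 2) (Fin 3 → Fin 2) ℂ) (i j : Fin 3) :
    Matrix (Fin 2 × Fin 2) (Fin 2 × Fin 2) ℂ :=
  Matrix.of fun p q => ∑ s : Fin 3 → Fin 2,
    if s i = p.1 ∧ s j = p.2 then
      ρ s (Function.update (Function.update s i q.1) j q.2)
    else 0

/-- The Pauli matrices `σ₁, σ₂, σ₃`. -/
def pauli : Fin 3 → Matrix (Fin 2) (Fin 2) ℂ :=
  ![!![0, 1; 1, 0], !![0, -Complex.I; Complex.I, 0], !![1, 0; 0, -1]]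

/-- The observable `v · σ` for a direction `v ∈ ℝ³`. -/
def spin (v : EuclideanSpace ℝ (Fin 3)) : Matrix (Fin 2) (Fin 2) ℂ :=
  ∑ m : Fin 3, (v m : ℂ) • pauli m

/-- The `n`-settings Cavalcanti–Jones–Wiseman–Reid expression
`F_n(ρ, μ) = (1/√n) |∑_k Tr(ρ (A_k ⊗ B_k))|` with `A_k = a_k · σ`, `B_k = b_k · σ`. -/
def cjwr {n : ℕ} (ρ : Matrix (Fin 2 × Fin 2) (Fin 2 × Fin 2) ℂ)
    (a b : Fin n → EuclideanSpace ℝ (Fin 3)) : ℝ :=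
  1 / √(n : ℝ) * ‖∑ k : Fin n, (ρ * (spin (a k) ⊗ₖ spin (b k))).trace‖

/-- `ρ` violates the `F₃` inequality: `F₃(ρ, μ) > 1` for some choice `μ` of unit vectors `a_k` and
orthonormal vectors `b_k` in `ℝ³`. -/
def ViolatesF3 (ρ : Matrix (Fin 2 × Fin 2) (Fin 2 × Fin 2) ℂ) : Prop :=
  ∃ a b : Fin 3 → EuclideanSpace ℝ (Fin 3),
    (∀ k, ‖a k‖ = 1) ∧ Orthonormal ℝ b ∧ 1 < cjwr ρ a b

/-- The correlation matrix `t_{mn} = Tr(ρ (σ_m ⊗ σ_n))`, whose entries are real for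
Hermitian `ρ`. -/
def corr (ρ : Matrix (Fin 2 × Fin 2) (Fin 2 × Fin 2) ℂ) : Matrix (Fin 3) (Fin 3) ℝ :=
  Matrix.of fun m n => (ρ * (pauli m ⊗ₖ pauli n)).trace.re

/-- `S = Tr(Tᵀ T)`, where `T` is the correlation matrix. -/
def steer (ρ : Matrix (Fin 2 × Fin 2) (Fin 2 × Fin 2) ℂ) : ℝ :=
  ((corr ρ).transpose * corr ρ).trace

/-- The spin-flipped operator `(σ₂ ⊗ σ₂) ρ* (σ₂ ⊗ σ₂)`, where `ρ*` is the entrywise complex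
conjugate. -/
def spinFlip (ρ : Matrix (Fin 2 × Fin 2) (Fin 2 × Fin 2) ℂ) :
    Matrix (Fin 2 × Fin 2) (Fin 2 × Fin 2) ℂ :=
  (pauli 1 ⊗ₖ pauli 1) * ρ.map star * (pauli 1 ⊗ₖ pauli 1)

/-- The square roots of the four eigenvalues (with algebraic multiplicity) of `ρ` times its
spin flip, in decreasing order. For positive semidefinite `ρ` these eigenvalues are real and
nonnegative. -/
def woottersList (ρ : Matrix (Fin 2 × Fin 2) (Fin 2 × Fin 2) ℂ) : List ℝ :=
  ((ρ * spinFlip ρ).charpoly.roots.map fun z : ℂ => √z.re).sort (fun x y => y ≤ x)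

/-- The (Wootters) concurrence `max {0, l₁ - l₂ - l₃ - l₄}` of a two-qubit state. -/
def concurrence (ρ : Matrix (Fin 2 × Fin 2) (Fin 2 × Fin 2) ℂ) : ℝ :=
  max 0 ((woottersList ρ).getD 0 0 - (woottersList ρ).getD 1 0
    - (woottersList ρ).getD 2 0 - (woottersList ρ).getD 3 0)

end ThreeQubit

end

/-! Arrange the amplitudes as a 4 × 2 matrix V, rows for the pair and columns for the traced-out
party, so that ρ = V Vᴴ. With τ = Vᵀ(σ₂ ⊗ σ₂)V, the nonzero eigenvalues of ρ times its spin flip are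
those of conj(τ)τ. Their square roots l ≥ m satisfy l² + m² = `tauSq` and lm = |det τ|, so C² = (l -
m)² = `tauSq` - 2|det τ| (`concurrence_sq`). Up to sign det τ is Cayley's hyperdeterminant, the same
for all three pairs, so it cancels in 2C_ij² - C_ik² - C_jk²; what remains is a polynomial identity
(`steer_eq_tauSq`).

For F₃, Cauchy–Schwarz bounds the expression by √S. The bound is attained on an orthonormal basis
whose images under T have equal length (`exists_orthonormal_eq_third`). -/

noncomputable section

namespace ThreeQubit

open scoped Kronecker Matrix

/-! ### Reduced states as V Vᴴ -/

/-- The amplitudes of `ψ` with the parties `i`, `j` read first and the third party last. -/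
def amplitude (ψ : Space) (i j : Fin 3) (x y z : Fin 2) : ℂ :=
  ψ (fun l => if l = i then x else if l = j then y else z)

/-- The `4 × 2` matrix of the amplitudes of a three-qubit vector. -/
def ampMatrix (f : Fin 2 → Fin 2 → Fin 2 → ℂ) : Matrix (Fin 2 × Fin 2) (Fin 2) ℂ :=
  Matrix.of fun p z => f p.1 p.2 z

theorem sum_triples {M : Type*} [AddCommMonoid M] {i j k : Fin 3} (hij : i ≠ j) (hik : i ≠ k)
    (hjk : j ≠ k) (g : (Fin 3 → Fin 2) → M) :
    ∑ s, g s = ∑ x : Fin 2, ∑ y : Fin 2, ∑ z : Fin 2,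
      g (fun l => if l = i then x else if l = j then y else z) := by
  rw [← Fintype.sum_prod_type', ← Fintype.sum_prod_type']
  have key : ∀ l, l = i ∨ l = j ∨ l = k := by omega
  refine Fintype.sum_equiv
    ⟨fun s => ((s i, s j), s k), fun w l => if l = i then w.1.1 else if l = j then w.1.2 else w.2,
      ?_, ?_⟩ _ _ ?_
  · intro s
    funext l
    rcases key l with rfl | rfl | rfl <;> simp [*, Ne.symm hij, Ne.symm hik, Ne.symm hjk]
  · rintro ⟨⟨x, y⟩, z⟩
    simp [hij.symm, hik.symm, hjk.symm]
  · intro s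
    congr 1
    funext l
    rcases key l with rfl | rfl | rfl <;> simp [*, Ne.symm hij, Ne.symm hik, Ne.symm hjk]

theorem reduced_pureDensity (ψ : Space) {i j k : Fin 3} (hij : i ≠ j) (hik : i ≠ k)
    (hjk : j ≠ k) :
    reduced (pureDensity ψ) i j = ampMatrix (amplitude ψ i j) * (ampMatrix (amplitude ψ i j))ᴴ := by
  ext p q
  have upd : ∀ x y z, Function.update (Function.update
      (fun l => if l = i then x else if l = j then y else z) i q.1) j q.2
      = fun l => if l = i then q.1 else if l = j then q.2 else (z : Fin 2) := by
    intro x y z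
    funext l
    by_cases h1 : l = j
    · subst h1; simp [hij.symm]
    · by_cases h2 : l = i
      · subst h2; simp [h1]
      · simp [h1, h2]
  simp only [reduced, Matrix.of_apply, sum_triples hij hik hjk, upd, pureDensity]
  simp only [if_true, if_neg hij.symm, Matrix.mul_apply, ampMatrix, Matrix.conjTranspose_apply,
    Matrix.of_apply, amplitude]
  have : ∀ x y : Fin 2, (∑ z : Fin 2, if x = p.1 ∧ y = p.2 then
      ψ (fun l => if l = i then x else if l = j then y else z) *
        star (ψ fun l => if l = i then q.1 else if l = j then q.2 else z) else 0) =
      if y = p.2 then if x = p.1 then ∑ z : Fin 2,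
      ψ (fun l => if l = i then x else if l = j then y else z) *
        star (ψ fun l => if l = i then q.1 else if l = j then q.2 else z) else 0 else 0 := by
    intro x y
    by_cases h1 : x = p.1 <;> by_cases h2 : y = p.2 <;> simp [h1, h2]
  simp only [this, Finset.sum_ite_eq', Finset.mem_univ, if_true]

theorem amplitude_swap_right (ψ : Space) {i j k : Fin 3} (hij : i ≠ j) (hik : i ≠ k)
    (hjk : j ≠ k) : amplitude ψ i k = fun x z y => amplitude ψ i j x y z := by
  funext x z y
  refine congrArg ψ ?_
  funext l
  have key : l = i ∨ l = j ∨ l = k := by omega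
  rcases key with rfl | rfl | rfl <;> simp [*, Ne.symm hij, Ne.symm hik, Ne.symm hjk]

theorem amplitude_rotate (ψ : Space) {i j k : Fin 3} (hij : i ≠ j) (hik : i ≠ k)
    (hjk : j ≠ k) : amplitude ψ j k = fun y z x => amplitude ψ i j x y z := by
  funext y z x
  refine congrArg ψ ?_
  funext l
  have key : l = i ∨ l = j ∨ l = k := by omega
  rcases key with rfl | rfl | rfl <;> simp_all [Ne.symm]

theorem sum_amplitude (ψ : Space) (hψ : ‖ψ‖ = 1) {i j k : Fin 3} (hij : i ≠ j) (hik : i ≠ k)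
    (hjk : j ≠ k) : ∑ x, ∑ y, ∑ z, amplitude ψ i j x y z * star (amplitude ψ i j x y z) = 1 := by
  have h := EuclideanSpace.norm_sq_eq ψ
  rw [hψ, sum_triples hij hik hjk, one_pow] at h
  simp only [amplitude, Complex.star_def, Complex.mul_conj']
  exact_mod_cast h.symm

/-! ### Spin flip and concurrence -/

/-- The symmetric `2 × 2` matrix `Vᵀ (σ₂ ⊗ σ₂) V`. -/
def tau (f : Fin 2 → Fin 2 → Fin 2 → ℂ) : Matrix (Fin 2) (Fin 2) ℂ :=
  (ampMatrix f)ᵀ * (pauli 1 ⊗ₖ pauli 1) * ampMatrix f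

theorem tau_apply (f : Fin 2 → Fin 2 → Fin 2 → ℂ) (z w : Fin 2) :
    tau f z w = -(f 0 0 z * f 1 1 w) + f 0 1 z * f 1 0 w + f 1 0 z * f 0 1 w
      - f 1 1 z * f 0 0 w := by
  simp [tau, Matrix.mul_apply, Fintype.sum_prod_type, pauli, ampMatrix]
  ring_nf

theorem tau_symm (f : Fin 2 → Fin 2 → Fin 2 → ℂ) : tau f 1 0 = tau f 0 1 := by
  simp only [tau_apply]; ring

/-- The hyperdeterminant is invariant under permuting the parties; this and the rotation below reach
the other two pairs. -/
theorem det_tau_swap_right (f : Fin 2 → Fin 2 → Fin 2 → ℂ) :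
    (tau fun x z y => f x y z).det = (tau f).det := by
  simp only [Matrix.det_fin_two, tau_apply]; ring

theorem det_tau_rotate (f : Fin 2 → Fin 2 → Fin 2 → ℂ) :
    (tau fun y z x => f x y z).det = (tau f).det := by
  simp only [Matrix.det_fin_two, tau_apply]; ring

/-- The sum of the squared moduli of the entries of `tau f`. -/
def tauSq (f : Fin 2 → Fin 2 → Fin 2 → ℂ) : ℝ :=
  ‖tau f 0 0‖ ^ 2 + 2 * ‖tau f 0 1‖ ^ 2 + ‖tau f 1 1‖ ^ 2

/-- AB and BA have the same characteristic polynomial up to a power of X; here A = V, and BA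
collapses to conj(τ)τ because σ₂ ⊗ σ₂ is real. -/
theorem mul_spinFlip_charpoly (f : Fin 2 → Fin 2 → Fin 2 → ℂ) :
    (ampMatrix f * (ampMatrix f)ᴴ * spinFlip (ampMatrix f * (ampMatrix f)ᴴ)).charpoly
      = Polynomial.X ^ 2 * ((tau f).map star * tau f).charpoly := by
  have hY : (pauli 1 ⊗ₖ pauli 1).map star = pauli 1 ⊗ₖ pauli 1 := by
    ext ⟨a, b⟩ ⟨c, d⟩
    fin_cases a <;> fin_cases b <;> fin_cases c <;> fin_cases d <;> simp [pauli]
  have hs : ∀ {l m n : Type} [Fintype m] (A : Matrix l m ℂ) (B : Matrix m n ℂ),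
      (A * B).map star = A.map star * B.map star := fun A B =>
    Matrix.map_mul (f := starRingEnd ℂ)
  have h1 : (tau f).map star = (ampMatrix f)ᴴ * (pauli 1 ⊗ₖ pauli 1) * (ampMatrix f).map star := by
    rw [tau, hs, hs, hY]; rfl
  have h2 : (ampMatrix f * (ampMatrix f)ᴴ).map star = (ampMatrix f).map star * (ampMatrix f)ᵀ := by
    rw [hs]; congr 1; ext; simp
  have h := Matrix.charpoly_mul_comm' (ampMatrix f)
    ((ampMatrix f)ᴴ * spinFlip (ampMatrix f * (ampMatrix f)ᴴ))
  have e : (ampMatrix f)ᴴ * spinFlip (ampMatrix f * (ampMatrix f)ᴴ) * ampMatrix f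
      = (tau f).map star * tau f := by
    rw [h1, spinFlip, h2, tau]
    simp only [Matrix.mul_assoc]
  rw [e, ← Matrix.mul_assoc] at h
  simp only [Fintype.card_prod, Fintype.card_fin] at h
  have hX : (Polynomial.X ^ 2 : Polynomial ℂ) ≠ 0 := by simp
  apply mul_left_cancel₀ hX
  rw [h]
  ring

/-- The eigenvalues of `conj(tau) * tau` have sum `tauSq` and product `‖det tau‖²`. -/
theorem charpoly_conj_tau_mul (f : Fin 2 → Fin 2 → Fin 2 → ℂ) :
    ((tau f).map star * tau f).charpoly = Polynomial.X ^ 2 -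
      Polynomial.C (tauSq f : ℂ) * Polynomial.X + Polynomial.C ((‖(tau f).det‖ ^ 2 : ℝ) : ℂ) := by
  rw [Matrix.charpoly_fin_two]
  congr 3
  · congr 1
    simp [Matrix.trace_fin_two, Matrix.mul_apply, tauSq, tau_symm, ← Complex.conj_mul']
    ring
  · rw [Matrix.det_mul]
    have : ((tau f).map star).det = star (tau f).det := by
      simp [Matrix.det_fin_two]
    rw [this, Complex.star_def, Complex.conj_mul']
    push_cast; rfl

theorem two_mul_norm_det_tau_le (f : Fin 2 → Fin 2 → Fin 2 → ℂ) :
    2 * ‖(tau f).det‖ ≤ tauSq f := by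
  rw [Matrix.det_fin_two, tau_symm, tauSq]
  have h := norm_sub_le (tau f 0 0 * tau f 1 1) (tau f 0 1 * tau f 0 1)
  rw [norm_mul, norm_mul] at h
  nlinarith [sq_nonneg (‖tau f 0 0‖ - ‖tau f 1 1‖)]

theorem concurrence_sq (f : Fin 2 → Fin 2 → Fin 2 → ℂ) :
    concurrence (ampMatrix f * (ampMatrix f)ᴴ) ^ 2 = tauSq f - 2 * ‖(tau f).det‖ := by
  obtain ⟨d, hd⟩ : ∃ d, d = ‖(tau f).det‖ := ⟨_, rfl⟩
  obtain ⟨t, ht⟩ : ∃ t, t = tauSq f := ⟨_, rfl⟩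
  have hdt : 2 * d ≤ t := by rw [hd, ht]; exact two_mul_norm_det_tau_le f
  have hd0 : 0 ≤ d := hd ▸ norm_nonneg _
  -- u and v will be l + m and l - m, since (l ± m)² = t ± 2d.
  obtain ⟨u, hu0, hu⟩ : ∃ u, 0 ≤ u ∧ u ^ 2 = t + 2 * d :=
    ⟨√(t + 2 * d), Real.sqrt_nonneg _, Real.sq_sqrt (by linarith)⟩
  obtain ⟨v, hv0, hv⟩ : ∃ v, 0 ≤ v ∧ v ^ 2 = t - 2 * d :=
    ⟨√(t - 2 * d), Real.sqrt_nonneg _, Real.sq_sqrt (by linarith)⟩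
  have hvu : v ≤ u := by nlinarith
  obtain ⟨l, hl⟩ : ∃ l, l = (u + v) / 2 := ⟨_, rfl⟩
  obtain ⟨m, hm⟩ : ∃ m, m = (u - v) / 2 := ⟨_, rfl⟩
  have hm0 : 0 ≤ m := by linarith
  have hml : m ≤ l := by linarith
  have hlm : l ^ 2 + m ^ 2 = t := by subst hl hm; linear_combination (hu + hv) / 2
  have hp : l ^ 2 * m ^ 2 = d ^ 2 := by
    have : l * m = d := by subst hl hm; linear_combination (hu - hv) / 4
    rw [← this]; ring
  have hroots : (ampMatrix f * (ampMatrix f)ᴴ *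
      spinFlip (ampMatrix f * (ampMatrix f)ᴴ)).charpoly.roots
      = {(0 : ℂ), 0, ((l ^ 2 : ℝ) : ℂ), ((m ^ 2 : ℝ) : ℂ)} := by
    have hfac : (ampMatrix f * (ampMatrix f)ᴴ *
        spinFlip (ampMatrix f * (ampMatrix f)ᴴ)).charpoly
        = (Multiset.map (fun a => Polynomial.X - Polynomial.C a)
          {(0 : ℂ), 0, ((l ^ 2 : ℝ) : ℂ), ((m ^ 2 : ℝ) : ℂ)}).prod := by
      rw [mul_spinFlip_charpoly, charpoly_conj_tau_mul, ← ht, ← hd, ← hlm, ← hp]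
      simp
      ring
    rw [hfac, Polynomial.roots_multiset_prod_X_sub_C]
  have hlist : woottersList (ampMatrix f * (ampMatrix f)ᴴ) = [l, m, 0, 0] := by
    have hms : ((ampMatrix f * (ampMatrix f)ᴴ *
      spinFlip (ampMatrix f * (ampMatrix f)ᴴ)).charpoly.roots.map fun z : ℂ => √z.re)
        = (([l, m, 0, 0] : List ℝ) : Multiset ℝ) := by
      rw [hroots]
      simp only [Multiset.insert_eq_cons, Multiset.map_cons, Multiset.map_singleton,
        Complex.ofReal_re, Complex.zero_re, Real.sqrt_zero, Real.sqrt_sq hm0,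
        Real.sqrt_sq (hm0.trans hml)]
      refine Multiset.coe_eq_coe.2 ?_
      exact (List.perm_append_comm (l₁ := [0, 0]) (l₂ := [l, m]))
    rw [woottersList, hms]
    refine List.Perm.eq_of_pairwise' (r := fun x y : ℝ => y ≤ x) ?_ ?_ ?_
    · exact Multiset.pairwise_sort _ _
    · simp [hm0, hml, hm0.trans hml]
    · exact Multiset.coe_eq_coe.1 (Multiset.sort_eq _ _)
  rw [concurrence, hlist]
  simp only [List.getD_cons_zero, List.getD_cons_succ, sub_zero]
  rw [max_eq_right (by linarith), ← ht, ← hd]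
  have : l - m = v := by linarith
  rw [this, hv]

/-! ### The F₃ inequality and S -/

/-- If the values of a continuous function on any orthonormal basis of `ℝ³` sum to `S`, then it is
constant, with value `S / 3`, on some orthonormal basis. -/
theorem exists_orthonormal_eq_third (q : EuclideanSpace ℝ (Fin 3) → ℝ)
    (hq : Continuous q) (S : ℝ)
    (hS : ∀ b : OrthonormalBasis (Fin 3) ℝ (EuclideanSpace ℝ (Fin 3)), ∑ r, q (b r) = S) :
    ∃ b : Fin 3 → EuclideanSpace ℝ (Fin 3), Orthonormal ℝ b ∧ ∀ r, q (b r) = S / 3 := by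
  have key : ∀ b : OrthonormalBasis (Fin 3) ℝ (EuclideanSpace ℝ (Fin 3)),
      q (b 0) + q (b 1) + q (b 2) = S := by
    intro b; rw [← hS b, Fin.sum_univ_three]
  have extend : ∀ b : Fin 3 → EuclideanSpace ℝ (Fin 3), Orthonormal ℝ b →
      q (b 0) + q (b 1) + q (b 2) = S := by
    intro b hb
    have h := key (OrthonormalBasis.mk hb (by
      rw [hb.linearIndependent.span_eq_top_of_card_eq_finrank (by simp)]))
    simpa using h
  -- The values on the standard basis average S / 3, and the sphere is connected.
  obtain ⟨v, hv, hqv⟩ : ∃ v : EuclideanSpace ℝ (Fin 3), ‖v‖ = 1 ∧ q v = S / 3 := by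
    have hc : IsPreconnected (Metric.sphere (0 : EuclideanSpace ℝ (Fin 3)) 1) :=
      isPreconnected_sphere (by
        rw [← Module.finrank_eq_rank]; simp) _ _
    let b := EuclideanSpace.basisFun (Fin 3) ℝ
    have hb := key b
    have hmem : ∀ r, b r ∈ Metric.sphere (0 : EuclideanSpace ℝ (Fin 3)) 1 := by
      intro r; simp [b.orthonormal.1 r]
    have hlo : ∃ r, q (b r) ≤ S / 3 := by
      by_contra! h
      linarith [h 0, h 1, h 2]
    have hhi : ∃ r, S / 3 ≤ q (b r) := by
      by_contra! h
      linarith [h 0, h 1, h 2]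
    obtain ⟨r, hr⟩ := hlo
    obtain ⟨s, hs⟩ := hhi
    obtain ⟨v, hv, e⟩ := hc.intermediate_value (hmem r) (hmem s) hq.continuousOn ⟨hr, hs⟩
    exact ⟨v, by simpa using hv, e⟩
  obtain ⟨b, hb⟩ : ∃ b : OrthonormalBasis (Fin 3) ℝ (EuclideanSpace ℝ (Fin 3)), b 0 = v := by
    obtain ⟨b, hb⟩ := Orthonormal.exists_orthonormalBasis_extension_of_card_eq (𝕜 := ℝ)
      (E := EuclideanSpace ℝ (Fin 3)) (ι := Fin 3) (by simp) (v := fun _ => v) (s := {0})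
      (by
        rw [orthonormal_iff_ite]
        rintro ⟨i, hi⟩ ⟨j, hj⟩
        simp only [Set.mem_singleton_iff] at hi hj
        subst hi hj
        simp [hv])
    exact ⟨b, hb 0 rfl⟩
  -- Rotate the other two basis vectors about v. As q(c 0) + q(c (π/2)) = 2S/3, some angle gives S /
  -- 3, and the third value is then forced.
  let c : ℝ → EuclideanSpace ℝ (Fin 3) := fun θ => Real.cos θ • b 1 + Real.sin θ • b 2
  let d : ℝ → EuclideanSpace ℝ (Fin 3) := fun θ => -Real.sin θ • b 1 + Real.cos θ • b 2
  have hin : ∀ r s, inner ℝ (b r) (b s) = if r = s then (1 : ℝ) else 0 :=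
    orthonormal_iff_ite.1 b.orthonormal
  have horth : ∀ θ, Orthonormal ℝ ![b 0, c θ, d θ] := by
    intro θ
    rw [orthonormal_iff_ite]
    have := Real.sin_sq_add_cos_sq θ
    intro r s
    fin_cases r <;> fin_cases s <;>
      simp [c, d, inner_add_left, inner_add_right, inner_smul_left, inner_smul_right, hin,
        -inner_self_eq_norm_sq_to_K] <;>
      linarith
  have hcc : Continuous fun θ => q (c θ) := by fun_prop
  have h0 : q v + q (c 0) + q (c (Real.pi / 2)) = S := by
    simpa [c, d, hb] using key b
  obtain ⟨θ, hθ⟩ : ∃ θ, q (c θ) = S / 3 := by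
    rcases le_total (q (c 0)) (S / 3) with h | h
    · exact mem_range_of_exists_le_of_exists_ge hcc ⟨0, h⟩ ⟨Real.pi / 2, by linarith⟩
    · exact mem_range_of_exists_le_of_exists_ge hcc ⟨Real.pi / 2, by linarith⟩ ⟨0, h⟩
  refine ⟨_, horth θ, ?_⟩
  have e := extend _ (horth θ)
  simp only [Matrix.cons_val_zero, Matrix.cons_val_one, Matrix.cons_val, hb] at e
  intro r
  fin_cases r
  · simpa [hb] using hqv
  · simpa using hθ
  · simp; linarith

/-- The image of `b` under the correlation matrix. -/
def corrVec (ρ : Matrix (Fin 2 × Fin 2) (Fin 2 × Fin 2) ℂ) (b : EuclideanSpace ℝ (Fin 3)) :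
    EuclideanSpace ℝ (Fin 3) :=
  WithLp.toLp 2 ((corr ρ).mulVec b.ofLp)

theorem continuous_corrVec (ρ : Matrix (Fin 2 × Fin 2) (Fin 2 × Fin 2) ℂ) :
    Continuous (corrVec ρ) := by
  unfold corrVec
  fun_prop

theorem steer_eq_sum (ρ : Matrix (Fin 2 × Fin 2) (Fin 2 × Fin 2) ℂ) :
    steer ρ = ∑ m, ∑ n, corr ρ m n ^ 2 := by
  rw [steer, Matrix.trace, Finset.sum_comm]
  simp [Matrix.mul_apply, sq]

/-- Parseval applied to each row of T. -/
theorem sum_norm_corrVec_sq (ρ : Matrix (Fin 2 × Fin 2) (Fin 2 × Fin 2) ℂ)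
    (b : OrthonormalBasis (Fin 3) ℝ (EuclideanSpace ℝ (Fin 3))) :
    ∑ r, ‖corrVec ρ (b r)‖ ^ 2 = steer ρ := by
  simp only [EuclideanSpace.norm_sq_eq]
  rw [Finset.sum_comm, steer_eq_sum]
  refine Finset.sum_congr rfl fun m _ => ?_
  have h := b.sum_sq_norm_inner_left (WithLp.toLp 2 (corr ρ m))
  rw [EuclideanSpace.norm_sq_eq] at h
  simp only [Real.norm_eq_abs, sq_abs] at h ⊢
  rw [← h]
  refine Finset.sum_congr rfl fun r _ => ?_
  simp [corrVec, Matrix.mulVec, dotProduct, PiLp.inner_apply, mul_comm]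

theorem trace_mul_pauli_eq_corr {ρ : Matrix (Fin 2 × Fin 2) (Fin 2 × Fin 2) ℂ}
    (hρ : ρ.IsHermitian) (m n : Fin 3) :
    (ρ * (pauli m ⊗ₖ pauli n)).trace = (corr ρ m n : ℂ) := by
  have hp : ∀ m, (pauli m)ᴴ = pauli m := by
    intro m
    ext a b
    fin_cases m <;> fin_cases a <;> fin_cases b <;> simp [pauli]
  symm
  rw [corr, Matrix.of_apply, ← Complex.conj_eq_iff_re, ← Complex.star_def,
    ← Matrix.trace_conjTranspose, Matrix.conjTranspose_mul, Matrix.conjTranspose_kronecker,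
    hp, hp, hρ.eq, Matrix.trace_mul_comm]

theorem trace_mul_spin {ρ : Matrix (Fin 2 × Fin 2) (Fin 2 × Fin 2) ℂ}
    (hρ : ρ.IsHermitian) (a b : EuclideanSpace ℝ (Fin 3)) :
    (ρ * (spin a ⊗ₖ spin b)).trace = (inner ℝ a (corrVec ρ b) : ℝ) := by
  have : spin a ⊗ₖ spin b = ∑ m, ∑ n, ((a m : ℂ) * (b n : ℂ)) • (pauli m ⊗ₖ pauli n) := by
    ext ⟨x, y⟩ ⟨z, w⟩
    simp [spin, Fin.sum_univ_three, Matrix.add_apply]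
    ring
  rw [this]
  simp only [Matrix.mul_sum, Matrix.trace_sum, Matrix.mul_smul, Matrix.trace_smul,
    trace_mul_pauli_eq_corr hρ, PiLp.inner_apply, corrVec, Matrix.mulVec, dotProduct]
  simp [Finset.sum_mul]
  refine Finset.sum_congr rfl fun m _ => Finset.sum_congr rfl fun n _ => by ring

theorem cjwr_eq {ρ : Matrix (Fin 2 × Fin 2) (Fin 2 × Fin 2) ℂ} (hρ : ρ.IsHermitian)
    (a b : Fin 3 → EuclideanSpace ℝ (Fin 3)) :
    cjwr ρ a b = 1 / √3 * |∑ r, inner ℝ (a r) (corrVec ρ (b r))| := by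
  simp only [cjwr, trace_mul_spin hρ, ← Complex.ofReal_sum, Complex.norm_real, Real.norm_eq_abs]
  norm_num

/-- A Hermitian operator violates the `F₃` inequality exactly when `S > 1`. -/
theorem violatesF3_iff {ρ : Matrix (Fin 2 × Fin 2) (Fin 2 × Fin 2) ℂ} (hρ : ρ.IsHermitian) :
    ViolatesF3 ρ ↔ 1 < steer ρ := by
  have h3 : 0 < √(3 : ℝ) := by positivity
  have h33 : √(3 : ℝ) ^ 2 = 3 := Real.sq_sqrt (by norm_num)
  constructor
  · rintro ⟨a, b, ha, hb, h⟩
    rw [cjwr_eq hρ, one_div_mul_eq_div, lt_div_iff₀ h3, one_mul] at h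
    let B := OrthonormalBasis.mk hb (by
      rw [hb.linearIndependent.span_eq_top_of_card_eq_finrank (by simp)])
    have hB : ∑ r, ‖corrVec ρ (b r)‖ ^ 2 = steer ρ := by
      rw [← sum_norm_corrVec_sq ρ B]
      simp [B]
    have h1 : |∑ r, inner ℝ (a r) (corrVec ρ (b r))| ≤ ∑ r, ‖corrVec ρ (b r)‖ := by
      refine (Finset.abs_sum_le_sum_abs _ _).trans (Finset.sum_le_sum fun r _ => ?_)
      simpa [ha r] using abs_real_inner_le_norm (a r) (corrVec ρ (b r))
    have h2 := sq_sum_le_card_mul_sum_sq (s := Finset.univ) (f := fun r => ‖corrVec ρ (b r)‖)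
    rw [hB] at h2
    simp only [Finset.card_univ, Fintype.card_fin] at h2
    push_cast at h2
    nlinarith
  · intro h
    obtain ⟨b, hb, hlen⟩ := exists_orthonormal_eq_third (fun v => ‖corrVec ρ v‖ ^ 2)
      (by have := continuous_corrVec ρ; fun_prop) _ (sum_norm_corrVec_sq ρ)
    have hpos : ∀ r, 0 < ‖corrVec ρ (b r)‖ := by
      intro r
      refine (norm_nonneg _).lt_of_ne fun h0 => ?_
      have := hlen r
      rw [← h0] at this
      linarith
    refine ⟨fun r => ‖corrVec ρ (b r)‖⁻¹ • corrVec ρ (b r), b, fun r => ?_, hb, ?_⟩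
    · rw [norm_smul, norm_inv, norm_norm, inv_mul_cancel₀ (hpos r).ne']
    · have hi : ∀ r, inner ℝ (‖corrVec ρ (b r)‖⁻¹ • corrVec ρ (b r)) (corrVec ρ (b r))
          = ‖corrVec ρ (b r)‖ := by
        intro r
        rw [real_inner_smul_left, real_inner_self_eq_norm_sq, sq, ← mul_assoc,
          inv_mul_cancel₀ (hpos r).ne', one_mul]
      have hl : ∀ r, 1 / √3 < ‖corrVec ρ (b r)‖ := by
        intro r
        refine lt_of_pow_lt_pow_left₀ 2 (norm_nonneg _) ?_
        rw [hlen r, div_pow, h33]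
        linarith
      rw [cjwr_eq hρ, one_div_mul_eq_div, lt_div_iff₀ h3, one_mul]
      simp only [hi]
      refine lt_of_lt_of_le ?_ (le_abs_self _)
      rw [Fin.sum_univ_three]
      have : √(3 : ℝ) = 1 / √3 + 1 / √3 + 1 / √3 := by
        field_simp; linarith
      linarith [hl 0, hl 1, hl 2]

/-! ### The polynomial identity for S -/

/-- Expanding ρ in products of Pauli matrices and the identity, 4 Tr ρ² is the sum of all sixteen
squared coefficients. Removing (Tr ρ)² and the squared local Bloch vectors, each 2 Tr ρ_A² - (Tr ρ)²
in form, leaves S. -/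
theorem steer_eq_trace {ρ : Matrix (Fin 2 × Fin 2) (Fin 2 × Fin 2) ℂ} (hρ : ρ.IsHermitian) :
    (steer ρ : ℂ) = 4 * (ρ * ρ).trace + ρ.trace ^ 2
      - 2 * ∑ x, ∑ x', (∑ y, ρ (x, y) (x', y)) * (∑ y, ρ (x', y) (x, y))
      - 2 * ∑ y, ∑ y', (∑ x, ρ (x, y) (x, y')) * (∑ x, ρ (x, y') (x, y)) := by
  rw [steer_eq_sum]
  push_cast
  simp only [← trace_mul_pauli_eq_corr hρ]
  simp [Matrix.trace, Matrix.mul_apply, Fintype.sum_prod_type, Fin.sum_univ_three, pauli]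
  ring_nf
  simp only [Complex.I_sq]
  ring

theorem tauSq_eq (f : Fin 2 → Fin 2 → Fin 2 → ℂ) :
    (tauSq f : ℂ) = ∑ z, ∑ w, tau f z w * star (tau f z w) := by
  simp [tauSq, tau_symm, ← Complex.mul_conj']
  ring

/-- The steering parameter of a normalized vector in terms of `tauSq` of the three pairs. -/
theorem steer_eq_tauSq (f : Fin 2 → Fin 2 → Fin 2 → ℂ)
    (hf : ∑ x, ∑ y, ∑ z, f x y z * star (f x y z) = 1) :
    steer (ampMatrix f * (ampMatrix f)ᴴ) = 1 + 2 * tauSq f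
      - tauSq (fun x z y => f x y z) - tauSq (fun y z x => f x y z) := by
  apply Complex.ofReal_injective
  rw [steer_eq_trace (Matrix.isHermitian_mul_conjTranspose_self _)]
  -- Replacing 1 by ‖ψ‖⁴ makes both sides homogeneous, so the identity holds without normalization.
  have h1 : (1 : ℂ) = (∑ x, ∑ y, ∑ z, f x y z * star (f x y z)) ^ 2 := by rw [hf, one_pow]
  push_cast
  rw [h1]
  simp only [tauSq_eq, tau_apply, Matrix.trace, Matrix.diag_apply, Matrix.mul_apply,
    Fintype.sum_prod_type, ampMatrix, Matrix.conjTranspose_apply, Matrix.of_apply,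
    Fin.sum_univ_two, star_sub, star_add, star_neg, star_mul']
  ring

end ThreeQubit
end

theorem corollary2 (ψ : ThreeQubit.Space) (hψ : ‖ψ‖ = 1)
    (ρ : Fin 3 → Fin 3 → Matrix (Fin 2 × Fin 2) (Fin 2 × Fin 2) ℂ)
    (hρ : ρ = ThreeQubit.reduced (ThreeQubit.pureDensity ψ))
    (C : Fin 3 → Fin 3 → ℝ) (hC : ∀ l m, C l m = ThreeQubit.concurrence (ρ l m))
    (i j k : Fin 3) (hij : i ≠ j) (hik : i ≠ k) (hjk : j ≠ k) :
    ThreeQubit.steer (ρ i j) = 1 + 2 * C i j ^ 2 - C i k ^ 2 - C j k ^ 2 ∧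
    (ThreeQubit.steer (ρ i j) > 1 ↔ C i j ^ 2 > (C i k ^ 2 + C j k ^ 2) / 2) ∧
    (ThreeQubit.ViolatesF3 (ρ i j) ↔ C i j ^ 2 > (C i k ^ 2 + C j k ^ 2) / 2) := by
  have main : ThreeQubit.steer (ρ i j) = 1 + 2 * C i j ^ 2 - C i k ^ 2 - C j k ^ 2 := by
    rw [hC, hC, hC, hρ, ThreeQubit.reduced_pureDensity ψ hij hik hjk,
      ThreeQubit.reduced_pureDensity ψ hik hij hjk.symm,
      ThreeQubit.reduced_pureDensity ψ hjk hij.symm hik.symm,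
      ThreeQubit.concurrence_sq, ThreeQubit.concurrence_sq, ThreeQubit.concurrence_sq,
      ThreeQubit.steer_eq_tauSq _ (ThreeQubit.sum_amplitude ψ hψ hij hik hjk),
      ThreeQubit.amplitude_swap_right ψ hij hik hjk, ThreeQubit.amplitude_rotate ψ hij hik hjk,
      ThreeQubit.det_tau_swap_right (ThreeQubit.amplitude ψ i j),
      ThreeQubit.det_tau_rotate (ThreeQubit.amplitude ψ i j)]
    ring
  have hiff : ThreeQubit.steer (ρ i j) > 1 ↔ C i j ^ 2 > (C i k ^ 2 + C j k ^ 2) / 2 := by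
    rw [main]
    constructor <;> intro h <;> linarith
  refine ⟨main, hiff, ?_⟩
  rw [← hiff]
  apply ThreeQubit.violatesF3_iff
  rw [hρ, ThreeQubit.reduced_pureDensity ψ hij hik hjk]
  exact Matrix.isHermitian_mul_conjTranspose_self _
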